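/- **Proposition 3.15.** For an integer $n\ge 2$ let $\Phi_n$ be the $n$-th cyclotomic polynomial, $\phi$ Euler's function, $m=\phi(n)=\deg\Phi_n$, $\omega(n)$ the number of distinct primes dividing $n$, and $\operatorname{rad}(n)$ the product of these primes. Let $\zeta_1,\dots,\zeta_m\in\mathbb{C}$ be the roots of $\Phi_n$ (the primitive $n$-th roots of unity), listed in any order, and let $V_{\Phi_n}=(\zeta_i^{\,j-1})_{1\le i,j\le m}\in\mathrm{GL}_m(\mathbb{C})$. For $A\in \mathrm{GL}_m(\mathbb{C})$ put $\mathrm{Cond}(A)=\|A\|\,\|A^{-1}\|$, where $\|A\|=\sqrt{\mathrm{Tr}(AA^*)}$ is the Frobenius norm. Then: - (a) if $\omega(n)=1$ (that is, $n=p^k$ with $p$ prime and $k\ge 1$), then $\mathrm{Cond}(V_{\Phi_n})\le 4m^2$; - (b) if $\omega(n)\le 3$, then $\mathrm{Cond}(V_{\Phi_n})\le 4\,\phi(\operatorname{rad}(n))^{\omega(n)-1}m^2$; - (c) if $\omega(n)=4$, then $\mathrm{Cond}(V_{\Phi_n})\le 4\,\phi(\operatorname{rad}(n))^{4}m^2$;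 - (d) if $\omega(n)=5$, then $\mathrm{Cond}(V_{\Phi_n})\le 4\,\phi(\operatorname{rad}(n))^{7}m^2$; - (e) if $\omega(n)=6$, then $\mathrm{Cond}(V_{\Phi_n})\le 4\,\phi(\operatorname{rad}(n))^{11}m^2$. -/

import Mathlib

noncomputable section

open scoped Matrix.Norms.Frobenius in
/-- The condition number `Cond(A) = ‖A‖ * ‖A⁻¹‖` of an invertible complex matrix, where `‖·‖` is
the Frobenius norm (see `frobenius_norm_eq_sqrt_trace`). -/
def frobeniusCond {m : ℕ} (A : GL (Fin m) ℂ) : ℝ :=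
  ‖(A : Matrix (Fin m) (Fin m) ℂ)‖ * ‖((A⁻¹ : GL (Fin m) ℂ) : Matrix (Fin m) (Fin m) ℂ)‖

open scoped Matrix.Norms.Frobenius in
/-- The norm used in `frobeniusCond` is `√ Tr(A A*)`. -/
theorem frobenius_norm_eq_sqrt_trace {m : ℕ} (A : Matrix (Fin m) (Fin m) ℂ) :
    ‖A‖ = Real.sqrt (Matrix.trace (A * A.conjTranspose)).re := by
  rw [Matrix.frobenius_norm_def, ← Real.sqrt_eq_rpow]
  congr 1
  simp only [Matrix.trace, Matrix.diag, Matrix.mul_apply, Matrix.conjTranspose_apply,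
    Complex.re_sum, Real.rpow_two]
  refine Finset.sum_congr rfl fun i _ => Finset.sum_congr rfl fun j _ => ?_
  rw [← Complex.normSq_eq_norm_sq, Complex.star_def, Complex.mul_conj, Complex.ofReal_re]

/-- An enumeration `ζ₁, …, ζ_m`, without repetition, of all complex roots of the `n`-th cyclotomic
polynomial, where `m = φ(n)`. -/
abbrev CyclotomicRootEnumeration (n : ℕ) : Type :=
  Fin n.totient ≃ {z : ℂ // (Polynomial.cyclotomic n ℂ).IsRoot z}

/-- The matrix `V_{Φ_n}`, with rows `(1, ζ_i, ζ_i², …, ζ_i^{m-1})`, attached to an enumeration of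
the roots of `Φ_n`. -/
def cyclotomicVandermonde {n : ℕ} (ζ : CyclotomicRootEnumeration n) : GL (Fin n.totient) ℂ :=
  Matrix.GeneralLinearGroup.mkOfDetNeZero (Matrix.vandermonde fun i => (ζ i : ℂ))
    (Matrix.det_vandermonde_ne_zero_iff.mpr (Subtype.val_injective.comp ζ.injective))

end

/-! Let `Φ = Φ_n` and `Ψ = (X ^ n - 1) / Φ`. By Lagrange interpolation the inverse of `V` has as
columns the coefficients of `Φ / (X - ζ_i)` divided by `Φ'(ζ_i)`. Differentiating `Φ Ψ = X ^ n - 1`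
gives `1 / Φ'(ζ) = ζ Ψ(ζ) / n`. So if `f` bounds the coefficients of `Φ` and `g` the absolute
coefficient sum of `Ψ`, every entry of the inverse is at most `(g / n) (m f) ≤ f g`, and the
condition number is at most `f g m ^ 2` (`frobeniusCond_cyclotomicVandermonde_le`). The product `f
g` is bounded one prime at a time. A prime already dividing `s` only substitutes `X ^ p`, so the
radical decides. A new prime replaces `f g` by `(φ(s) + 1) (f g) ^ 2`
(`CyclotomicCoeffBounds.mul_of_not_dvd`). Adding primes in increasing order gives monomials in the
`p_i - 1`, which are then compared with powers of their product. -/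

section

open Polynomial Finset

/-! ### Absolute coefficient sums of integer polynomials. -/

/-- The sum of the absolute values of the coefficients of an integer polynomial. -/
def Polynomial.absCoeffSum (P : ℤ[X]) : ℤ := ∑ i ∈ P.support, |P.coeff i|

namespace Polynomial

theorem sum_abs_coeff_le_absCoeffSum (P : ℤ[X]) (S : Finset ℕ) :
    ∑ i ∈ S, |P.coeff i| ≤ P.absCoeffSum := by
  rw [← Finset.sum_filter_add_sum_filter_not S (· ∈ P.support)]
  have h : ∑ i ∈ S with i ∉ P.support, |P.coeff i| = 0 :=
    Finset.sum_eq_zero fun i hi => by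
      simp [notMem_support_iff.mp (Finset.mem_filter.mp hi).2]
  rw [h, add_zero]
  exact Finset.sum_le_sum_of_subset_of_nonneg (fun i hi => (Finset.mem_filter.mp hi).2)
    fun _ _ _ => abs_nonneg _

theorem absCoeffSum_nonneg (P : ℤ[X]) : 0 ≤ P.absCoeffSum :=
  Finset.sum_nonneg fun _ _ => abs_nonneg _

theorem absCoeffSum_add_le (P Q : ℤ[X]) :
    (P + Q).absCoeffSum ≤ P.absCoeffSum + Q.absCoeffSum := by
  refine le_trans (Finset.sum_le_sum fun i _ => ?_) <| (Finset.sum_add_distrib).le.trans <|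
    add_le_add (sum_abs_coeff_le_absCoeffSum P (P + Q).support)
      (sum_abs_coeff_le_absCoeffSum Q (P + Q).support)
  rw [coeff_add]
  exact abs_add_le _ _

theorem absCoeffSum_sum_le {ι : Type*} (S : Finset ι) (P : ι → ℤ[X]) :
    (∑ i ∈ S, P i).absCoeffSum ≤ ∑ i ∈ S, (P i).absCoeffSum := by
  classical
  induction S using Finset.induction_on with
  | empty => simp [absCoeffSum]
  | insert a S ha ih =>
    rw [Finset.sum_insert ha, Finset.sum_insert ha]
    exact (absCoeffSum_add_le _ _).trans (by gcongr)

theorem absCoeffSum_C_mul_X_pow_mul_le (c : ℤ) (k : ℕ) (P : ℤ[X]) :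
    (C c * X ^ k * P).absCoeffSum ≤ |c| * P.absCoeffSum := by
  have hR (i : ℕ) : (C c * X ^ k * P).coeff i = c * if k ≤ i then P.coeff (i - k) else 0 := by
    rw [mul_assoc, coeff_C_mul, coeff_X_pow_mul']
  generalize C c * X ^ k * P = R at hR
  have h : ∀ i ∈ R.support, k ≤ i := fun i hi => by
    by_contra hk
    exact mem_support_iff.mp hi (by rw [hR, if_neg hk, mul_zero])
  have hinj : Set.InjOn (fun i => i - k) (R.support : Set ℕ) := fun i hi j hj hij =>
    tsub_left_inj (h i hi) (h j hj) |>.mp hij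
  calc R.absCoeffSum = ∑ i ∈ R.support, |c| * |P.coeff (i - k)| :=
        Finset.sum_congr rfl fun i hi => by rw [hR, if_pos (h i hi), abs_mul]
    _ = |c| * ∑ i ∈ R.support.image (fun i => i - k), |P.coeff i| := by
        rw [← Finset.mul_sum, Finset.sum_image hinj]
    _ ≤ _ := mul_le_mul_of_nonneg_left (sum_abs_coeff_le_absCoeffSum _ _) (abs_nonneg _)

theorem absCoeffSum_mul_le (P Q : ℤ[X]) {c : ℤ} (hc : ∀ i, |P.coeff i| ≤ c) :
    (P * Q).absCoeffSum ≤ (P.natDegree + 1) * c * Q.absCoeffSum := by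
  conv_lhs => rw [P.as_sum_range_C_mul_X_pow, Finset.sum_mul]
  refine (absCoeffSum_sum_le _ _).trans ?_
  refine (Finset.sum_le_sum (g := fun _ => c * Q.absCoeffSum) fun i _ => ?_).trans ?_
  · exact (absCoeffSum_C_mul_X_pow_mul_le _ _ _).trans
      (mul_le_mul_of_nonneg_right (hc i) Q.absCoeffSum_nonneg)
  · simp [mul_assoc]

theorem absCoeffSum_one : (1 : ℤ[X]).absCoeffSum = 1 := by
  have : (1 : ℤ[X]).support = {0} := by
    rw [← C_1, ← monomial_zero_left]
    exact support_monomial 0 one_ne_zero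
  simp [absCoeffSum, this]

theorem absCoeffSum_expand_le (p : ℕ) (P : ℤ[X]) :
    (expand ℤ p P).absCoeffSum ≤ P.absCoeffSum := by
  rw [expand_eq_sum, Polynomial.sum]
  refine (absCoeffSum_sum_le _ _).trans (Finset.sum_le_sum fun i _ => ?_)
  have := absCoeffSum_C_mul_X_pow_mul_le (P.coeff i) (p * i) 1
  rw [mul_one, pow_mul] at this
  refine this.trans ?_
  simp [absCoeffSum_one]

/-! ### Inverse cyclotomic polynomials and the recursion over primes. -/

/-- The inverse cyclotomic polynomial `(X ^ n - 1) / Φ_n`. -/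
noncomputable def inverseCyclotomic (n : ℕ) : ℤ[X] := ∏ d ∈ n.properDivisors, cyclotomic d ℤ

theorem cyclotomic_mul_inverseCyclotomic {n : ℕ} (hn : n ≠ 0) :
    cyclotomic n ℤ * inverseCyclotomic n = X ^ n - 1 := by
  rw [inverseCyclotomic, ← prod_cyclotomic_eq_X_pow_sub_one (Nat.pos_of_ne_zero hn),
    ← Nat.cons_self_properDivisors hn, Finset.prod_cons]

theorem inverseCyclotomic_mul_of_dvd {p s : ℕ} (hp : p.Prime) (hs : s ≠ 0) (h : p ∣ s) :
    inverseCyclotomic (s * p) = expand ℤ p (inverseCyclotomic s) := by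
  apply mul_left_cancel₀ (cyclotomic_ne_zero (s * p) ℤ)
  rw [cyclotomic_mul_inverseCyclotomic (mul_ne_zero hs hp.ne_zero),
    ← cyclotomic_expand_eq_cyclotomic hp h, ← map_mul, cyclotomic_mul_inverseCyclotomic hs]
  simp [← pow_mul, mul_comm]

theorem inverseCyclotomic_mul_of_not_dvd {p s : ℕ} (hp : p.Prime) (hs : s ≠ 0) (h : ¬ p ∣ s) :
    inverseCyclotomic (s * p) = cyclotomic s ℤ * expand ℤ p (inverseCyclotomic s) := by
  apply mul_left_cancel₀ (cyclotomic_ne_zero (s * p) ℤ)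
  rw [cyclotomic_mul_inverseCyclotomic (mul_ne_zero hs hp.ne_zero), ← mul_assoc,
    ← cyclotomic_expand_eq_cyclotomic_mul hp h, ← map_mul, cyclotomic_mul_inverseCyclotomic hs]
  simp [← pow_mul, mul_comm]

/-- `f` bounds every coefficient of `Φ_n`, and `g` bounds the sum of the absolute values of the
coefficients of `(X ^ n - 1) / Φ_n`. -/
structure CyclotomicCoeffBounds (n f g : ℕ) : Prop where
  abs_coeff_le : ∀ i, |(cyclotomic n ℤ).coeff i| ≤ (f : ℤ)
  absCoeffSum_le : (inverseCyclotomic n).absCoeffSum ≤ (g : ℤ)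

theorem CyclotomicCoeffBounds.of_prime {p : ℕ} (hp : p.Prime) : CyclotomicCoeffBounds p 1 2 := by
  have := Fact.mk hp
  constructor
  · intro i
    simp only [cyclotomic_prime, finsetSum_coeff, coeff_X_pow, Finset.sum_ite_eq]
    split_ifs <;> simp
  · have h : inverseCyclotomic p = C 1 * X ^ 1 * 1 + C (-1) * X ^ 0 * 1 := by
      rw [inverseCyclotomic, hp.prod_properDivisors, cyclotomic_one]
      simp [sub_eq_add_neg]
    rw [h]
    refine (absCoeffSum_add_le _ _).trans ((add_le_add (absCoeffSum_C_mul_X_pow_mul_le _ _ _)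
      (absCoeffSum_C_mul_X_pow_mul_le _ _ _)).trans ?_)
    simp [absCoeffSum_one]

theorem CyclotomicCoeffBounds.mul_of_dvd {p s f g : ℕ} (hp : p.Prime) (hs : s ≠ 0) (h : p ∣ s)
    (H : CyclotomicCoeffBounds s f g) : CyclotomicCoeffBounds (s * p) f g := by
  constructor
  · intro i
    rw [← cyclotomic_expand_eq_cyclotomic hp h, coeff_expand hp.pos]
    split_ifs
    · exact H.abs_coeff_le _
    · simp
  · rw [inverseCyclotomic_mul_of_dvd hp hs h]
    exact (absCoeffSum_expand_le _ _).trans H.absCoeffSum_le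

theorem CyclotomicCoeffBounds.mul_of_forall_dvd {s f g : ℕ} (hs : s ≠ 0)
    (H : CyclotomicCoeffBounds s f g) (t : ℕ) (ht : t ≠ 0)
    (hst : ∀ p, p.Prime → p ∣ t → p ∣ s) : CyclotomicCoeffBounds (s * t) f g := by
  induction t using induction_on_primes with
  | zero => exact absurd rfl ht
  | one => simpa using H
  | prime_mul p a hp ih =>
    have ha : a ≠ 0 := right_ne_zero_of_mul ht
    have := ih ha fun q hq hqa => hst q hq (hqa.mul_left p)
    rw [mul_comm p a, ← mul_assoc]
    exact this.mul_of_dvd hp (mul_ne_zero hs ha) ((hst p hp (dvd_mul_right p a)).mul_right a)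

/-- The numbers `p j + s t` with `j ≤ φ(s)` are pairwise distinct. -/
theorem mul_add_mul_injOn {p s : ℕ} (hs : 2 ≤ s) (h : Nat.Coprime p s) (T : ℕ) :
    Set.InjOn (fun x : ℕ × ℕ => p * x.1 + s * x.2)
      (range (s.totient + 1) ×ˢ range T : Finset (ℕ × ℕ)) := by
  rintro ⟨j, t⟩ hx ⟨j', t'⟩ hy hxy
  simp only [coe_product, coe_range, Set.mem_prod, Set.mem_Iio] at hx hy hxy
  have hφ := Nat.totient_lt s hs
  have hmod : p * j ≡ p * j' [MOD s] := by
    have h1 : p * j + s * t ≡ p * j' + s * t' [MOD s] := by rw [hxy]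
    simpa [Nat.ModEq] using h1
  -- Since `j, j' ≤ φ(s) < s`, the residue modulo `s` determines `j`.
  have hj : j = j' := (Nat.ModEq.cancel_left_of_coprime h.symm hmod).eq_of_lt_of_lt
    (by omega) (by omega)
  subst hj
  have : s * t = s * t' := by omega
  rw [Nat.eq_of_mul_eq_mul_left (by omega) this]

/-- As power series, `Φ_{sp} = Φ_s(X ^ p) / Φ_s = -Φ_s(X ^ p) Ψ_s ∑ X ^ (s t)`. The shifts `p j + s
t` are distinct, so a given coefficient meets each coefficient of `Ψ_s` at most once, with a weight
of size at most `f`. -/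
theorem CyclotomicCoeffBounds.abs_coeff_mul_le {p s f g : ℕ} (hp : p.Prime) (hs : 2 ≤ s)
    (h : ¬ p ∣ s) (H : CyclotomicCoeffBounds s f g) (l : ℕ) :
    |(cyclotomic (s * p) ℤ).coeff l| ≤ (f * g : ℤ) := by
  set Φ := cyclotomic s ℤ
  set Ψ := inverseCyclotomic s
  -- The geometric series is truncated; as `s (l + 1) > l`, the coefficient of degree `l` is
  -- unaffected.
  have key : cyclotomic (s * p) ℤ * (1 - X ^ (s * (l + 1))) =
      -(expand ℤ p Φ * (∑ t ∈ range (l + 1), (X ^ s) ^ t) * Ψ) := by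
    have h1 := geom_sum_mul (X ^ s : ℤ[X]) (l + 1)
    rw [← cyclotomic_mul_inverseCyclotomic (by omega : s ≠ 0)] at h1
    rw [cyclotomic_expand_eq_cyclotomic_mul hp h, pow_mul]
    linear_combination (cyclotomic (s * p) ℤ) * h1
  have hcoeff : (cyclotomic (s * p) ℤ).coeff l =
      -∑ x ∈ range (s.totient + 1) ×ˢ range (l + 1),
        Φ.coeff x.1 * if p * x.1 + s * x.2 ≤ l then Ψ.coeff (l - (p * x.1 + s * x.2)) else 0 := by
    have h0 : (cyclotomic (s * p) ℤ).coeff l =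
        (cyclotomic (s * p) ℤ * (1 - X ^ (s * (l + 1)))).coeff l := by
      rw [mul_sub, mul_one, coeff_sub, coeff_mul_X_pow', if_neg (by nlinarith), sub_zero]
    have hexp : expand ℤ p Φ = ∑ j ∈ range (s.totient + 1), C (Φ.coeff j) * X ^ (p * j) := by
      conv_lhs => rw [Φ.as_sum_range_C_mul_X_pow, natDegree_cyclotomic]
      simp [map_sum, pow_mul]
    rw [h0, key, hexp, Finset.sum_mul_sum, ← Finset.sum_product', Finset.sum_mul, coeff_neg,
      finsetSum_coeff]
    congr 1
    refine Finset.sum_congr rfl fun x _ => ?_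
    rw [mul_assoc (C _), ← pow_mul, ← pow_add, mul_assoc, coeff_C_mul, coeff_X_pow_mul']
  rw [hcoeff, abs_neg]
  calc _ ≤ ∑ x ∈ range (s.totient + 1) ×ˢ range (l + 1),
        |Φ.coeff x.1 * if p * x.1 + s * x.2 ≤ l then Ψ.coeff (l - (p * x.1 + s * x.2)) else 0| :=
        Finset.abs_sum_le_sum_abs _ _
    _ ≤ ∑ x ∈ range (s.totient + 1) ×ˢ range (l + 1),
        (f : ℤ) * |if p * x.1 + s * x.2 ≤ l then Ψ.coeff (l - (p * x.1 + s * x.2)) else 0| := by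
        refine Finset.sum_le_sum fun x _ => ?_
        rw [abs_mul]
        exact mul_le_mul_of_nonneg_right (H.abs_coeff_le _) (abs_nonneg _)
    _ = f * ∑ x ∈ range (s.totient + 1) ×ˢ range (l + 1) with p * x.1 + s * x.2 ≤ l,
          |Ψ.coeff (l - (p * x.1 + s * x.2))| := by
        rw [← Finset.mul_sum, Finset.sum_filter]
        congr 1
        refine Finset.sum_congr rfl fun x _ => ?_
        split_ifs <;> simp
    _ = f * ∑ i ∈ ((range (s.totient + 1) ×ˢ range (l + 1)).filter
          fun x => p * x.1 + s * x.2 ≤ l).image fun x => l - (p * x.1 + s * x.2),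
          |Ψ.coeff i| := by
        rw [Finset.sum_image]
        intro x hx y hy hxy
        simp only [coe_filter, Set.mem_ofPred_eq] at hx hy hxy
        apply mul_add_mul_injOn hs ((Nat.Prime.coprime_iff_not_dvd hp).mpr h) (l + 1)
          (mem_coe.mpr hx.1) (mem_coe.mpr hy.1)
        simp only
        omega
    _ ≤ f * g := by
        gcongr
        exact (sum_abs_coeff_le_absCoeffSum _ _).trans H.absCoeffSum_le

theorem CyclotomicCoeffBounds.mul_of_not_dvd {p s f g : ℕ} (hp : p.Prime) (hs : 2 ≤ s)
    (h : ¬ p ∣ s) (H : CyclotomicCoeffBounds s f g) :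
    CyclotomicCoeffBounds (s * p) (f * g) ((s.totient + 1) * f * g) := by
  constructor
  · exact_mod_cast H.abs_coeff_mul_le hp hs h
  · rw [inverseCyclotomic_mul_of_not_dvd hp (by omega) h]
    refine (absCoeffSum_mul_le _ _ H.abs_coeff_le).trans ?_
    rw [natDegree_cyclotomic]
    push_cast
    gcongr
    exact (absCoeffSum_expand_le _ _).trans H.absCoeffSum_le

end Polynomial

/-! ### The inverse Vandermonde matrix and its norm. -/

open scoped Matrix.Norms.Frobenius in
theorem Matrix.frobenius_norm_le_of_entry_le {m : ℕ} (A : Matrix (Fin m) (Fin m) ℂ) {c : ℝ}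
    (hc : 0 ≤ c) (h : ∀ i j, ‖A i j‖ ≤ c) : ‖A‖ ≤ m * c := by
  rw [Matrix.frobenius_norm_def, ← Real.sqrt_eq_rpow]
  refine Real.sqrt_le_iff.mpr ⟨by positivity, ?_⟩
  calc ∑ i, ∑ j, ‖A i j‖ ^ (2 : ℝ) ≤ ∑ _i : Fin m, ∑ _j : Fin m, c ^ 2 := by
        simp only [Real.rpow_two]
        gcongr
        exact h _ _
    _ = (m * c) ^ 2 := by
        simp
        ring

theorem Polynomial.norm_eval_intCast_le_absCoeffSum (P : ℤ[X]) {z : ℂ} (hz : ‖z‖ = 1) :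
    ‖(P.map (Int.castRingHom ℂ)).eval z‖ ≤ P.absCoeffSum := by
  rw [eval_map, eval₂_eq_sum, Polynomial.sum, absCoeffSum, Int.cast_sum]
  refine (norm_sum_le _ _).trans (Finset.sum_le_sum fun i _ => ?_)
  simp [hz]

theorem Polynomial.norm_coeff_divByMonic_X_sub_C_le (P : ℂ[X]) {z : ℂ} (hz : ‖z‖ = 1) {f : ℝ}
    (hf : 0 ≤ f) (h : ∀ i, ‖P.coeff i‖ ≤ f) (k : ℕ) :
    ‖(P /ₘ (X - C z)).coeff k‖ ≤ P.natDegree * f := by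
  rw [coeff_divByMonic_X_sub_C]
  refine (norm_sum_le_of_le (f := fun i => z ^ (i - (k + 1)) * P.coeff i)
    (n := fun _ => f) _ fun i _ => ?_).trans ?_
  · simpa [hz] using h i
  · rw [Finset.sum_const, Nat.card_Icc, nsmul_eq_mul]
    gcongr
    omega

/-- The derivative of `Φ_n` at a root `z` is inverse to `z Ψ_n(z) / n`. -/
theorem Polynomial.eval_cyclotomic_divByMonic_mul {n : ℕ} (hn : n ≠ 0) {z : ℂ}
    (hz : (cyclotomic n ℂ).IsRoot z) :
    z * ((inverseCyclotomic n).map (Int.castRingHom ℂ)).eval z / n *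
      (cyclotomic n ℂ /ₘ (X - C z)).eval z = 1 := by
  have hn' : (n : ℂ) ≠ 0 := Nat.cast_ne_zero.mpr hn
  have := NeZero.mk hn'
  have hpow : z ^ n = 1 := (isRoot_cyclotomic_iff.mp hz).pow_eq_one
  have hQ : (cyclotomic n ℂ /ₘ (X - C z)).eval z = (derivative (cyclotomic n ℂ)).eval z := by
    have := congrArg (eval z) (divByMonic_add_X_sub_C_mul_derivative_divByMonic_eq_derivative
      (cyclotomic n ℂ) z)
    simpa using this
  have hprod := congrArg (map (Int.castRingHom ℂ)) (cyclotomic_mul_inverseCyclotomic hn)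
  simp only [Polynomial.map_mul, map_cyclotomic, Polynomial.map_sub, Polynomial.map_pow, map_X,
    Polynomial.map_one] at hprod
  have hder := congrArg (fun P => eval z (derivative P)) hprod
  simp only [derivative_mul, eval_add, eval_mul, hz.eq_zero, zero_mul, add_zero] at hder
  rw [hQ, div_mul_eq_mul_div, div_eq_one_iff_eq hn', mul_assoc, mul_comm (eval z _), hder]
  simp only [derivative_sub, derivative_X_pow, derivative_one, sub_zero, eval_mul, eval_pow, eval_X,
    map_natCast, eval_natCast]
  rw [mul_left_comm, ← pow_succ', Nat.sub_add_cancel (Nat.pos_of_ne_zero hn), hpow, mul_one]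

/-- Column `i` lists the coefficients of the Lagrange basis polynomial that is `1` at `ζ i` and `0`
at the other roots. -/
theorem cyclotomicVandermonde_inv_apply {n : ℕ} (hn : n ≠ 0) (ζ : CyclotomicRootEnumeration n)
    (j i : Fin n.totient) :
    ((cyclotomicVandermonde ζ)⁻¹ : GL (Fin n.totient) ℂ) j i =
      (ζ i : ℂ) * ((inverseCyclotomic n).map (Int.castRingHom ℂ)).eval (ζ i : ℂ) / n *
        (cyclotomic n ℂ /ₘ (X - C (ζ i : ℂ))).coeff j := by
  set U : Matrix (Fin n.totient) (Fin n.totient) ℂ := Matrix.of fun j i =>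
    (ζ i : ℂ) * ((inverseCyclotomic n).map (Int.castRingHom ℂ)).eval (ζ i : ℂ) / n *
        (cyclotomic n ℂ /ₘ (X - C (ζ i : ℂ))).coeff j with hU
  have hdeg (z : ℂ) : (cyclotomic n ℂ /ₘ (X - C z)).natDegree < n.totient := by
    rw [natDegree_divByMonic _ (monic_X_sub_C z), natDegree_cyclotomic, natDegree_X_sub_C]
    have := Nat.totient_pos.mpr (Nat.pos_of_ne_zero hn)
    omega
  have hVU : ((cyclotomicVandermonde ζ : GL (Fin n.totient) ℂ) :
      Matrix (Fin n.totient) (Fin n.totient) ℂ) * U = 1 := by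
    ext a b
    have h1 : (((cyclotomicVandermonde ζ : GL (Fin n.totient) ℂ) :
        Matrix (Fin n.totient) (Fin n.totient) ℂ) * U) a b =
        (ζ b : ℂ) * ((inverseCyclotomic n).map (Int.castRingHom ℂ)).eval (ζ b : ℂ) / n *
          (cyclotomic n ℂ /ₘ (X - C (ζ b : ℂ))).eval (ζ a : ℂ) := by
      rw [eval_eq_sum_range' (hdeg _), ← Fin.sum_univ_eq_sum_range
        (fun k => (cyclotomic n ℂ /ₘ (X - C (ζ b : ℂ))).coeff k * (ζ a : ℂ) ^ k),
        Finset.mul_sum, Matrix.mul_apply]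
      refine Finset.sum_congr rfl fun k _ => ?_
      simp only [cyclotomicVandermonde, Matrix.GeneralLinearGroup.mkOfDetNeZero, hU,
        Matrix.of_apply]
      change (ζ a : ℂ) ^ (k : ℕ) * _ = _
      ring
    rw [h1]
    rcases eq_or_ne a b with rfl | hab
    · rw [eval_cyclotomic_divByMonic_mul hn (ζ a).2, Matrix.one_apply_eq]
    · rw [Matrix.one_apply_ne hab]
      have h2 := congrArg (eval (ζ a : ℂ)) (mul_divByMonic_eq_iff_isRoot.mpr (ζ b).2)
      rw [eval_mul, (ζ a).2.eq_zero, eval_sub, eval_X, eval_C] at h2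
      have h3 : (ζ a : ℂ) - ζ b ≠ 0 :=
        sub_ne_zero.mpr fun h => hab (ζ.injective (Subtype.ext h))
      rw [(mul_eq_zero.mp h2).resolve_left h3, mul_zero]
  rw [Matrix.coe_units_inv, Matrix.inv_eq_right_inv hVU, hU, Matrix.of_apply]

open scoped Matrix.Norms.Frobenius in
theorem frobeniusCond_cyclotomicVandermonde_le {n f g : ℕ} (hn : n ≠ 0)
    (H : CyclotomicCoeffBounds n f g) (ζ : CyclotomicRootEnumeration n) :
    frobeniusCond (cyclotomicVandermonde ζ) ≤ (f * g : ℕ) * (n.totient : ℝ) ^ 2 := by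
  have hn' : (n : ℂ) ≠ 0 := Nat.cast_ne_zero.mpr hn
  have := NeZero.mk hn'
  have hnorm (i : Fin n.totient) : ‖(ζ i : ℂ)‖ = 1 :=
    Complex.norm_eq_one_of_pow_eq_one (isRoot_cyclotomic_iff.mp (ζ i).2).pow_eq_one hn
  have hV := Matrix.frobenius_norm_le_of_entry_le
    ((cyclotomicVandermonde ζ : GL (Fin n.totient) ℂ) : Matrix (Fin n.totient) (Fin n.totient) ℂ) zero_le_one fun i j => by
      change ‖(ζ i : ℂ) ^ (j : ℕ)‖ ≤ 1
      simp [hnorm]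
  have hcoeff (i : ℕ) : ‖(cyclotomic n ℂ).coeff i‖ ≤ f := by
    rw [← map_cyclotomic_int, coeff_map, eq_intCast, Complex.norm_intCast]
    exact_mod_cast H.abs_coeff_le i
  have hinv := Matrix.frobenius_norm_le_of_entry_le
    (((cyclotomicVandermonde ζ)⁻¹ : GL (Fin n.totient) ℂ) : Matrix (Fin n.totient) (Fin n.totient) ℂ)
    (Nat.cast_nonneg (f * g)) fun j i => by
      rw [cyclotomicVandermonde_inv_apply hn, norm_mul, norm_div, norm_mul, hnorm, one_mul,
        Complex.norm_natCast]
      have h1 := norm_coeff_divByMonic_X_sub_C_le _ (hnorm i) (Nat.cast_nonneg f) hcoeff j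
      have h2 : ‖((inverseCyclotomic n).map (Int.castRingHom ℂ)).eval (ζ i : ℂ)‖ ≤ g :=
        (norm_eval_intCast_le_absCoeffSum _ (hnorm i)).trans (by exact_mod_cast H.absCoeffSum_le)
      have hn0 : (0 : ℝ) < n := Nat.cast_pos.mpr (Nat.pos_of_ne_zero hn)
      rw [natDegree_cyclotomic] at h1
      have h3 : (n.totient : ℝ) ≤ n := Nat.cast_le.mpr (Nat.totient_le n)
      -- Enlarging `φ(n)` to `n` cancels the denominator.
      calc _ ≤ (g : ℝ) / n * (n * f) := by
            gcongr
            exact h1.trans (by gcongr)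
        _ = (f * g : ℕ) := by
            push_cast
            field_simp
  calc _ ≤ (n.totient * 1 : ℝ) * (n.totient * (f * g : ℕ)) :=
        mul_le_mul hV hinv (norm_nonneg _) (by positivity)
    _ = _ := by ring

/-! ### Bounds for products of up to six distinct primes. -/

/-- `s ≥ 2` has totient `t`, and `b` bounds the product of the height of `Φ_s` and the sum of the
absolute values of the coefficients of `(X ^ s - 1) / Φ_s`. -/
structure CyclotomicProductBound (s t b : ℕ) : Prop where
  two_le : 2 ≤ s
  totient_eq : s.totient = t
  exists_bounds : ∃ f g, CyclotomicCoeffBounds s f g ∧ f * g ≤ b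

namespace CyclotomicProductBound

theorem of_prime {q : ℕ} (hq : (q + 1).Prime) : CyclotomicProductBound (q + 1) q 2 :=
  ⟨hq.two_le, Nat.totient_prime hq, 1, 2, .of_prime hq, le_rfl⟩

/-- Primes are written `q + 1`, so that totients are products of the `q`. The parameter `c` lets `t
+ 1` be rounded up to a monomial. -/
theorem mul_prime {s t b q c : ℕ} (H : CyclotomicProductBound s t b) (hq : (q + 1).Prime)
    (h : ¬ q + 1 ∣ s) (hc : t + 1 ≤ c) :
    CyclotomicProductBound (s * (q + 1)) (t * q) (c * b ^ 2) := by
  obtain ⟨hs, rfl, f, g, hfg, hb⟩ := H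
  refine ⟨hs.trans (Nat.le_mul_of_pos_right s hq.pos), ?_, _, _, hfg.mul_of_not_dvd hq hs h, ?_⟩
  · rw [Nat.totient_mul ((Nat.Prime.coprime_iff_not_dvd hq).mpr h).symm, Nat.totient_prime hq,
      Nat.add_sub_cancel]
  · calc f * g * ((s.totient + 1) * f * g) = (s.totient + 1) * (f * g) ^ 2 := by ring
      _ ≤ _ := by gcongr

variable {q₁ q₂ q₃ q₄ q₅ q₆ : ℕ}

theorem two_primes (h₁ : (q₁ + 1).Prime) (h₂ : (q₂ + 1).Prime) (h₁₂ : q₁ < q₂) :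
    CyclotomicProductBound ((q₁ + 1) * (q₂ + 1)) (q₁ * q₂) (4 * q₂) := by
  have := (of_prime h₁).mul_prime h₂ (c := q₂)
    (by rw [Nat.prime_dvd_prime_iff_eq h₂ h₁]; omega) h₁₂
  convert! this using 1
  ring

/-- Absorbs the `+ 1` of `φ(s) + 1` by replacing the last factor with that of the next, larger
prime. -/
theorem mul_add_one_le {t a b : ℕ} (ht : 0 < t) (hab : a < b) : t * a + 1 ≤ t * b := by
  nlinarith

theorem three_primes (h₁ : (q₁ + 1).Prime) (h₂ : (q₂ + 1).Prime) (h₃ : (q₃ + 1).Prime)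
    (h₁₂ : q₁ < q₂) (h₂₃ : q₂ < q₃) :
    CyclotomicProductBound ((q₁ + 1) * (q₂ + 1) * (q₃ + 1)) (q₁ * q₂ * q₃)
      (2 ^ 4 * q₁ * q₂ ^ 2 * q₃) := by
  have := h₁.two_le
  have := (two_primes h₁ h₂ h₁₂).mul_prime h₃ (c := q₁ * q₃)
    (by simp only [h₃.dvd_mul, Nat.prime_dvd_prime_iff_eq h₃, h₁, h₂]; omega)
    (mul_add_one_le (by omega) h₂₃)
  convert! this using 1
  ring

theorem four_primes (h₁ : (q₁ + 1).Prime) (h₂ : (q₂ + 1).Prime) (h₃ : (q₃ + 1).Prime)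
    (h₄ : (q₄ + 1).Prime) (h₁₂ : q₁ < q₂) (h₂₃ : q₂ < q₃) (h₃₄ : q₃ < q₄) :
    CyclotomicProductBound ((q₁ + 1) * (q₂ + 1) * (q₃ + 1) * (q₄ + 1)) (q₁ * q₂ * q₃ * q₄)
      (2 ^ 8 * q₁ ^ 3 * q₂ ^ 5 * q₃ ^ 2 * q₄) := by
  have := h₁.two_le
  have := (three_primes h₁ h₂ h₃ h₁₂ h₂₃).mul_prime h₄ (c := q₁ * q₂ * q₄)
    (by simp only [h₄.dvd_mul, Nat.prime_dvd_prime_iff_eq h₄, h₁, h₂, h₃]; omega)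
    (mul_add_one_le (Nat.mul_pos (by omega) (by omega)) h₃₄)
  convert! this using 1
  ring

theorem five_primes (h₁ : (q₁ + 1).Prime) (h₂ : (q₂ + 1).Prime) (h₃ : (q₃ + 1).Prime)
    (h₄ : (q₄ + 1).Prime) (h₅ : (q₅ + 1).Prime)
    (h₁₂ : q₁ < q₂) (h₂₃ : q₂ < q₃) (h₃₄ : q₃ < q₄) (h₄₅ : q₄ < q₅) :
    CyclotomicProductBound ((q₁ + 1) * (q₂ + 1) * (q₃ + 1) * (q₄ + 1) * (q₅ + 1))
      (q₁ * q₂ * q₃ * q₄ * q₅) (2 ^ 16 * q₁ ^ 7 * q₂ ^ 11 * q₃ ^ 5 * q₄ ^ 2 * q₅) := by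
  have := h₁.two_le
  have := (four_primes h₁ h₂ h₃ h₄ h₁₂ h₂₃ h₃₄).mul_prime h₅ (c := q₁ * q₂ * q₃ * q₅)
    (by simp only [h₅.dvd_mul, Nat.prime_dvd_prime_iff_eq h₅, h₁, h₂, h₃, h₄]; omega)
    (mul_add_one_le (Nat.mul_pos (Nat.mul_pos (by omega) (by omega)) (by omega)) h₄₅)
  convert! this using 1
  ring

theorem six_primes (h₁ : (q₁ + 1).Prime) (h₂ : (q₂ + 1).Prime) (h₃ : (q₃ + 1).Prime)
    (h₄ : (q₄ + 1).Prime) (h₅ : (q₅ + 1).Prime) (h₆ : (q₆ + 1).Prime)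
    (h₁₂ : q₁ < q₂) (h₂₃ : q₂ < q₃) (h₃₄ : q₃ < q₄) (h₄₅ : q₄ < q₅) (h₅₆ : q₅ < q₆) :
    CyclotomicProductBound ((q₁ + 1) * (q₂ + 1) * (q₃ + 1) * (q₄ + 1) * (q₅ + 1) * (q₆ + 1))
      (q₁ * q₂ * q₃ * q₄ * q₅ * q₆)
      (2 ^ 32 * q₁ ^ 15 * q₂ ^ 23 * q₃ ^ 11 * q₄ ^ 5 * q₅ ^ 2 * q₆) := by
  have := h₁.two_le
  have := (five_primes h₁ h₂ h₃ h₄ h₅ h₁₂ h₂₃ h₃₄ h₄₅).mul_prime h₆ (c := q₁ * q₂ * q₃ * q₄ * q₆)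
    (by simp only [h₆.dvd_mul, Nat.prime_dvd_prime_iff_eq h₆, h₁, h₂, h₃, h₄, h₅]; omega)
    (mul_add_one_le (Nat.mul_pos (Nat.mul_pos (Nat.mul_pos (by omega) (by omega)) (by omega))
      (by omega)) h₅₆)
  convert! this using 1
  ring

theorem mono {s t b b' : ℕ} (H : CyclotomicProductBound s t b) (h : b ≤ b') :
    CyclotomicProductBound s t b' :=
  let ⟨f, g, hfg, hb⟩ := H.exists_bounds
  ⟨H.two_le, H.totient_eq, f, g, hfg, hb.trans h⟩

end CyclotomicProductBound

/-! ### Small prime gaps and the primes of the radical. -/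

theorem Nat.Prime.four_le_of_two_lt {q : ℕ} (hq : (q + 1).Prime) (h : 2 < q) : 4 ≤ q := by
  by_contra hlt
  obtain rfl : q = 3 := by omega
  norm_num at hq

theorem Nat.Prime.six_le_of_four_lt {q : ℕ} (hq : (q + 1).Prime) (h : 4 < q) : 6 ≤ q := by
  by_contra hlt
  obtain rfl : q = 5 := by omega
  norm_num at hq

theorem Nat.Prime.ten_le_of_six_lt {q : ℕ} (hq : (q + 1).Prime) (h : 6 < q) : 10 ≤ q := by
  by_contra hlt
  obtain rfl | rfl | rfl : q = 7 ∨ q = 8 ∨ q = 9 := by omega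
  all_goals norm_num at hq

theorem Nat.Prime.twelve_le_of_ten_lt {q : ℕ} (hq : (q + 1).Prime) (h : 10 < q) : 12 ≤ q := by
  by_contra hlt
  obtain rfl : q = 11 := by omega
  norm_num at hq

theorem Nat.exists_strictMono_prime_radical {n k : ℕ}
    (hk : ArithmeticFunction.cardDistinctFactors n = k) :
    ∃ q : Fin k → ℕ, StrictMono q ∧ (∀ i, (q i + 1).Prime) ∧
      UniqueFactorizationMonoid.radical n = ∏ i, (q i + 1) := by
  have hcard : n.primeFactors.card = k := by
    rw [← hk, ArithmeticFunction.cardDistinctFactors_apply, Nat.primeFactors, List.card_toFinset]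
  set e := n.primeFactors.orderEmbOfFin hcard
  have hp (i : Fin k) : (e i).Prime :=
    Nat.prime_of_mem_primeFactors (n.primeFactors.orderEmbOfFin_mem hcard i)
  have he (i : Fin k) : e i - 1 + 1 = e i := Nat.sub_add_cancel (hp i).one_lt.le
  refine ⟨fun i => e i - 1, fun i j hij => ?_, fun i => by simpa only [he] using hp i, ?_⟩
  · have := e.strictMono hij
    have := (hp i).one_lt
    simp only
    omega
  · simp only [he]
    rw [Nat.radical_eq_prod_primeFactors, ← Finset.prod_coe_sort]
    exact (Fintype.prod_equiv (n.primeFactors.orderIsoOfFin hcard).toEquiv _ _ fun i => rfl).symm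

/-- The bound on the radical of `n` gives the condition number for `n`. -/
theorem CyclotomicProductBound.frobeniusCond_le {n t e : ℕ} (hn : n ≠ 0)
    (H : CyclotomicProductBound (UniqueFactorizationMonoid.radical n) t (4 * t ^ e))
    (ζ : CyclotomicRootEnumeration n) :
    frobeniusCond (cyclotomicVandermonde ζ) ≤
      4 * ((UniqueFactorizationMonoid.radical n).totient : ℝ) ^ e * (n.totient : ℝ) ^ 2 := by
  obtain ⟨-, rfl, f, g, hfg, hb⟩ := H
  obtain ⟨d, hd⟩ : UniqueFactorizationMonoid.radical n ∣ n :=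
    UniqueFactorizationMonoid.radical_dvd_self
  -- Every prime of the cofactor `d` divides the radical, so the bounds carry over unchanged.
  have hn' : CyclotomicCoeffBounds n f g := by
    rw [hd]
    refine hfg.mul_of_forall_dvd (Nat.radical_pos n).ne' d ?_ fun p hp hpd => ?_
    · rintro rfl
      exact hn (by simpa using hd)
    · have hpn : p ∈ (UniqueFactorizationMonoid.radical n).primeFactors := by
        rw [Nat.primeFactors_radical]
        exact Nat.mem_primeFactors.mpr ⟨hp, hd ▸ hpd.mul_left _, hn⟩
      exact Nat.dvd_of_mem_primeFactors hpn
  refine (frobeniusCond_cyclotomicVandermonde_le hn hn' ζ).trans ?_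
  gcongr
  exact_mod_cast hb

/-! ### Comparison of the monomials with powers of the totient. -/

section

open UniqueFactorizationMonoid CyclotomicProductBound

variable {n : ℕ}

theorem cyclotomicProductBound_radical_one
    (h : ArithmeticFunction.cardDistinctFactors n = 1) :
    ∃ t, CyclotomicProductBound (radical n) t (4 * t ^ 0) := by
  obtain ⟨q, -, hp, hr⟩ := Nat.exists_strictMono_prime_radical h
  rw [Fin.prod_univ_one] at hr
  rw [hr]
  exact ⟨_, (of_prime (hp 0)).mono (by norm_num)⟩

theorem cyclotomicProductBound_radical_two
    (h : ArithmeticFunction.cardDistinctFactors n = 2) :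
    ∃ t, CyclotomicProductBound (radical n) t (4 * t ^ 1) := by
  obtain ⟨q, hq, hp, hr⟩ := Nat.exists_strictMono_prime_radical h
  rw [Fin.prod_univ_two] at hr
  have h₀ := (hp 0).two_le
  rw [hr]
  refine ⟨_, (two_primes (hp 0) (hp 1) (hq (by decide))).mono ?_⟩
  nlinarith

theorem cyclotomicProductBound_radical_three
    (h : ArithmeticFunction.cardDistinctFactors n = 3) :
    ∃ t, CyclotomicProductBound (radical n) t (4 * t ^ 2) := by
  obtain ⟨q, hq, hp, hr⟩ := Nat.exists_strictMono_prime_radical h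
  rw [Fin.prod_univ_three] at hr
  have h₀ := (hp 0).two_le
  have h₀₁ : q 0 < q 1 := hq (by decide)
  have h₁₂ : q 1 < q 2 := hq (by decide)
  have h₂ := (hp 2).four_le_of_two_lt (by omega)
  rw [hr]
  refine ⟨_, (three_primes (hp 0) (hp 1) (hp 2) h₀₁ h₁₂).mono ?_⟩
  generalize q 0 = a, q 1 = b, q 2 = c at *
  calc 2 ^ 4 * a * b ^ 2 * c = 4 * (a * b ^ 2 * c) * (1 * 4) := by ring
    _ ≤ 4 * (a * b ^ 2 * c) * (a * c) := by gcongr; omega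
    _ = _ := by ring

theorem cyclotomicProductBound_radical_four
    (h : ArithmeticFunction.cardDistinctFactors n = 4) :
    ∃ t, CyclotomicProductBound (radical n) t (4 * t ^ 4) := by
  obtain ⟨q, hq, hp, hr⟩ := Nat.exists_strictMono_prime_radical h
  rw [Fin.prod_univ_four] at hr
  have h₀ := (hp 0).two_le
  have h₀₁ : q 0 < q 1 := hq (by decide)
  have h₁₂ : q 1 < q 2 := hq (by decide)
  have h₂₃ : q 2 < q 3 := hq (by decide)
  have h₂ := (hp 2).four_le_of_two_lt (by omega)
  rw [hr]
  refine ⟨_, (four_primes (hp 0) (hp 1) (hp 2) (hp 3) h₀₁ h₁₂ h₂₃).mono ?_⟩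
  generalize q 0 = a, q 1 = b, q 2 = c, q 3 = d at *
  -- The excess `b` is absorbed by `c`, and the constant by `d ^ 3`.
  calc 2 ^ 8 * a ^ 3 * b ^ 5 * c ^ 2 * d
      = 4 * (a ^ 3 * b ^ 4 * c ^ 2 * d) * (1 * (b * 1) * 4 ^ 3) := by ring
    _ ≤ 4 * (a ^ 3 * b ^ 4 * c ^ 2 * d) * (a * (c * c) * d ^ 3) := by gcongr <;> omega
    _ = _ := by ring

theorem cyclotomicProductBound_radical_five
    (h : ArithmeticFunction.cardDistinctFactors n = 5) :
    ∃ t, CyclotomicProductBound (radical n) t (4 * t ^ 7) := by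
  obtain ⟨q, hq, hp, hr⟩ := Nat.exists_strictMono_prime_radical h
  rw [Fin.prod_univ_five] at hr
  have h₀₁ : q 0 < q 1 := hq (by decide)
  have h₁₂ : q 1 < q 2 := hq (by decide)
  have h₂₃ : q 2 < q 3 := hq (by decide)
  have h₃₄ : q 3 < q 4 := hq (by decide)
  have h₀ := (hp 0).two_le
  have h₂ := (hp 2).four_le_of_two_lt (by omega)
  have h₃ := (hp 3).six_le_of_four_lt (by omega)
  have h₄ := (hp 4).ten_le_of_six_lt (by omega)
  rw [hr]
  refine ⟨_, (five_primes (hp 0) (hp 1) (hp 2) (hp 3) (hp 4) h₀₁ h₁₂ h₂₃ h₃₄).mono ?_⟩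
  generalize q 0 = a, q 1 = b, q 2 = c, q 3 = d, q 4 = e at *
  -- The excess `b ^ 4` goes to `c` and `d`; `2 ^ 14 ≤ 10 ^ 6` goes to `e ^ 6`.
  calc 2 ^ 16 * a ^ 7 * b ^ 11 * c ^ 5 * d ^ 2 * e
      = 4 * (a ^ 7 * b ^ 7 * c ^ 5 * d ^ 2 * e) * (b ^ 2 * (b ^ 2 * 1 ^ 3) * 2 ^ 14) := by ring
    _ ≤ 4 * (a ^ 7 * b ^ 7 * c ^ 5 * d ^ 2 * e) * (b ^ 2 * (b ^ 2 * 1 ^ 3) * 10 ^ 6) :=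
        Nat.mul_le_mul_left _ (Nat.mul_le_mul_left _ (by norm_num))
    _ ≤ 4 * (a ^ 7 * b ^ 7 * c ^ 5 * d ^ 2 * e) * (c ^ 2 * (d ^ 2 * d ^ 3) * e ^ 6) := by
        gcongr <;> omega
    _ = _ := by ring

theorem cyclotomicProductBound_radical_six
    (h : ArithmeticFunction.cardDistinctFactors n = 6) :
    ∃ t, CyclotomicProductBound (radical n) t (4 * t ^ 11) := by
  obtain ⟨q, hq, hp, hr⟩ := Nat.exists_strictMono_prime_radical h
  rw [Fin.prod_univ_six] at hr
  have h₀₁ : q 0 < q 1 := hq (by decide)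
  have h₁₂ : q 1 < q 2 := hq (by decide)
  have h₂₃ : q 2 < q 3 := hq (by decide)
  have h₃₄ : q 3 < q 4 := hq (by decide)
  have h₄₅ : q 4 < q 5 := hq (by decide)
  have h₀ := (hp 0).two_le
  have h₂ := (hp 2).four_le_of_two_lt (by omega)
  have h₃ := (hp 3).six_le_of_four_lt (by omega)
  have h₄ := (hp 4).ten_le_of_six_lt (by omega)
  have h₅ := (hp 5).twelve_le_of_ten_lt (by omega)
  rw [hr]
  refine ⟨_, (six_primes (hp 0) (hp 1) (hp 2) (hp 3) (hp 4) (hp 5) h₀₁ h₁₂ h₂₃ h₃₄ h₄₅).mono ?_⟩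
  generalize q 0 = a, q 1 = b, q 2 = c, q 3 = d, q 4 = e, q 5 = f at *
  -- The sixth prime must be used as at least 13: `2 ^ 30 ≤ 12 ^ 9`, whereas `10 ^ 9` is too small.
  calc 2 ^ 32 * a ^ 15 * b ^ 23 * c ^ 11 * d ^ 5 * e ^ 2 * f
      = 4 * (a ^ 11 * b ^ 11 * c ^ 11 * d ^ 5 * e ^ 2 * f) *
        (b ^ 6 * (a ^ 4 * b ^ 5) * b * 2 ^ 30) := by ring
    _ ≤ 4 * (a ^ 11 * b ^ 11 * c ^ 11 * d ^ 5 * e ^ 2 * f) *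
        (b ^ 6 * (a ^ 4 * b ^ 5) * b * 12 ^ 9) :=
        Nat.mul_le_mul_left _ (Nat.mul_le_mul_left _ (by norm_num))
    _ ≤ 4 * (a ^ 11 * b ^ 11 * c ^ 11 * d ^ 5 * e ^ 2 * f) *
        (d ^ 6 * (e ^ 4 * e ^ 5) * f * f ^ 9) := by gcongr <;> omega
    _ = _ := by ring

end

end

theorem proposition3p15 (n : ℕ) (hn : 2 ≤ n) (ζ : CyclotomicRootEnumeration n) :
    (ArithmeticFunction.cardDistinctFactors n = 1 →
      frobeniusCond (cyclotomicVandermonde ζ) ≤ 4 * (n.totient : ℝ) ^ 2) ∧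
    (ArithmeticFunction.cardDistinctFactors n ≤ 3 →
      frobeniusCond (cyclotomicVandermonde ζ) ≤
        4 * ((UniqueFactorizationMonoid.radical n).totient : ℝ) ^
          (ArithmeticFunction.cardDistinctFactors n - 1) * (n.totient : ℝ) ^ 2) ∧
    (ArithmeticFunction.cardDistinctFactors n = 4 →
      frobeniusCond (cyclotomicVandermonde ζ) ≤
        4 * ((UniqueFactorizationMonoid.radical n).totient : ℝ) ^ 4 * (n.totient : ℝ) ^ 2) ∧
    (ArithmeticFunction.cardDistinctFactors n = 5 →
      frobeniusCond (cyclotomicVandermonde ζ) ≤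
        4 * ((UniqueFactorizationMonoid.radical n).totient : ℝ) ^ 7 * (n.totient : ℝ) ^ 2) ∧
    (ArithmeticFunction.cardDistinctFactors n = 6 →
      frobeniusCond (cyclotomicVandermonde ζ) ≤
        4 * ((UniqueFactorizationMonoid.radical n).totient : ℝ) ^ 11 * (n.totient : ℝ) ^ 2) := by
  have hn0 : n ≠ 0 := by omega
  have one (h : ArithmeticFunction.cardDistinctFactors n = 1) :=
    (cyclotomicProductBound_radical_one h).choose_spec.frobeniusCond_le hn0 ζ
  refine ⟨fun h => by simpa using one h, fun h => ?_, fun h => ?_, fun h => ?_, fun h => ?_⟩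
  -- Positivity of `ω(n)` rules out truncation in the exponent `ω(n) - 1`.
  · have hpos := ArithmeticFunction.cardDistinctFactors_pos.mpr (show 1 < n by omega)
    obtain h1 | h2 | h3 : ArithmeticFunction.cardDistinctFactors n = 1 ∨
        ArithmeticFunction.cardDistinctFactors n = 2 ∨
        ArithmeticFunction.cardDistinctFactors n = 3 := by omega
    · rw [h1]
      exact one h1
    · rw [h2]
      exact (cyclotomicProductBound_radical_two h2).choose_spec.frobeniusCond_le hn0 ζ
    · rw [h3]
      exact (cyclotomicProductBound_radical_three h3).choose_spec.frobeniusCond_le hn0 ζ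
  · exact (cyclotomicProductBound_radical_four h).choose_spec.frobeniusCond_le hn0 ζ
  · exact (cyclotomicProductBound_radical_five h).choose_spec.frobeniusCond_le hn0 ζ
  · exact (cyclotomicProductBound_radical_six h).choose_spec.frobeniusCond_le hn0 ζ
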